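/- Let $N>n$ be natural numbers and $0<t<T$. Let $X^{(1)},\dots,X^{(n)}$ be independent rate 1 Poisson processes on $[0,\infty)$ (with $X^{(i)}_0=0$). For times $s\le s'$ and integers $a_i,b_i$, write $\mathbb P(\{(s,a_i)\to(s',b_i)\};\text{ no intersection})$ for the probability that the walks $u\mapsto a_i+X^{(i)}_u-X^{(i)}_s$, $1\le i\le n$, are at pairwise distinct locations at every time $u\in[s,s']$, and that the $i$-th walk is at $b_i$ at time $s'$ for every $i$. The bus process $L_u=(L^{(1)}_u,\dots,L^{(n)}_u)$, $L^{(i)}_u=1-i+X^{(i)}_u$, is considered conditionally on the event that the $L^{(i)}$ do not intersect during $[0,T]$ and that $L_T=(N,N-1,\dots,N-n+1)$; let $\mathcal L_t(x_1,\dots,x_n)$ be the conditional probability that $L_t=(x_1,\dots,x_n)$. Use the convention $1/k!=0$ for integers $k<0$. For all integers $x_1>\dots>x_n$, $$\mathbb P(\{(0,1-i)\to(t,x_i)\};\text{ no intersection})=\det\Big(e^{-t}\frac{t^{x_j+i-1}}{(x_j+i-1)!}\Big)_{i,j=1}^n,$$ $$\mathbb P(\{(t,x_i)\to(T,N+1-i)\};\text{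 no intersection})=\det\Big(e^{-(T-t)}\frac{(T-t)^{N+1-i-x_j}}{(N+1-i-x_j)!}\Big)_{i,j=1}^n,$$ $$\mathbb P(\{(0,1-i)\to(T,N+1-i)\};\text{ no intersection})=\det\Big(e^{-T}\frac{T^{N+i-j}}{(N+i-j)!}\Big)_{i,j=1}^n,$$ and $\mathcal L_t(x_1,\dots,x_n)$ is the product of the first two of these probabilities divided by the third. Moreover $$\Big[\det\Big(\frac1{(N+i-j)!}\Big)_{i,j=1}^n\Big]^{-1}=\prod_{i=1}^n\frac{(N+i-1)!}{(i-1)!}.$$ Let $p=t/T$ and $y_j=x_j+n-1$. If $N+n-1\ge y_1>\dots>y_n\ge 0$, then $$\mathcal L_t(x_1,\dots,x_n)=[(N+n-1)!]^{-n}\Big[\prod_{i=1}^n\frac{(N+i-1)!}{(i-1)!}\Big](p-p^2)^{-\frac{n(n-1)}2}\prod_{i<j}(y_j-y_i)^2\prod_{j=1}^n\binom{N+n-1}{y_j}p^{y_j}(1-p)^{N+n-1-y_j},$$ and $\mathcal L_t(x_1,\dots,x_n)=0$ for all other $(x_1,\dots,x_n)\in\mathbb Z^n$. That is, $(y_1,\dots,y_n)$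 is distributed as the Krawtchouk Unitary Ensemble: the probability distribution on $\{N+n-1\ge y_1>\dots>y_n\ge0\}$ proportional to $\prod_{i<j}(y_j-y_i)^2\prod_{j}\binom{N+n-1}{y_j}p^{y_j}(1-p)^{N+n-1-y_j}$. -/

import Mathlib

open MeasureTheory ProbabilityTheory
open scoped NNReal

noncomputable section

namespace BusModel

/-- `X` is a (counting) Poisson process of rate `r` under `μ`: it starts at `0`, its paths are
nondecreasing and right-continuous with values in `ℕ`, its increments are independent, and
`X t - X s` is Poisson distributed with parameter `r * (t - s)` for `s ≤ t`. -/
structure IsPoissonProcess {Ω : Type*} [MeasurableSpace Ω] (r : ℝ≥0) (X : ℝ≥0 → Ω → ℕ)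
    (μ : Measure Ω) : Prop where
  measurable : ∀ s, Measurable (X s)
  start : ∀ ω, X 0 ω = 0
  mono : ∀ ω, Monotone fun s => X s ω
  rightCont : ∀ ω s, ContinuousWithinAt (fun u => X u ω) (Set.Ici s) s
  indepIncrements : HasIndepIncrements X μ
  increments : ∀ s t, s ≤ t → μ.map (fun ω => X t ω - X s ω) = poissonMeasure (r * (t - s))

/-- Initial locations: the buses are indexed by `i = 0, …, n - 1`, and bus `i`
(the `(i+1)`-st one) starts at `1 - (i + 1) = -i`. -/
def initial (n : ℕ) (i : Fin n) : ℤ := -(i : ℤ)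

/-- Terminal locations `N, N - 1, …, N - n + 1`. -/
def terminal (n N : ℕ) (i : Fin n) : ℤ := (N : ℤ) - (i : ℤ)

/-- Location at time `u` of walker `i` which is at `a i` at time `s` and moves
by the increments of `X i`. -/
def walk {Ω : Type*} {n : ℕ} (X : Fin n → ℝ≥0 → Ω → ℕ) (s : ℝ≥0) (a : Fin n → ℤ)
    (u : ℝ≥0) (i : Fin n) (ω : Ω) : ℤ :=
  a i + ((X i u ω : ℤ) - (X i s ω : ℤ))

/-- No two of the walks started from `a` at time `s` are at the same location at the same time
during `[s, t]`. -/
def noIntersection {Ω : Type*} {n : ℕ} (X : Fin n → ℝ≥0 → Ω → ℕ) (s : ℝ≥0) (a : Fin n → ℤ)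
    (t : ℝ≥0) : Set Ω :=
  {ω | ∀ u ∈ Set.Icc s t, ∀ i j : Fin n, i ≠ j → walk X s a u i ω ≠ walk X s a u j ω}

/-- The event `{(s, a i) → (t, b i), 1 ≤ i ≤ n; no intersection}`. -/
def passage {Ω : Type*} {n : ℕ} (X : Fin n → ℝ≥0 → Ω → ℕ) (s : ℝ≥0) (a : Fin n → ℤ)
    (t : ℝ≥0) (b : Fin n → ℤ) : Set Ω :=
  noIntersection X s a t ∩ {ω | ∀ i, walk X s a t i ω = b i}

/-- The law of the bus model on path space: `μ` conditioned on the buses not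
intersecting during `[0, T]` and being at the terminal locations at time `T`. -/
def busLaw {Ω : Type*} [MeasurableSpace Ω] (μ : Measure Ω) {n : ℕ} (X : Fin n → ℝ≥0 → Ω → ℕ)
    (N : ℕ) (T : ℝ≥0) : Measure Ω :=
  ProbabilityTheory.cond μ (passage X 0 (initial n) T (terminal n N))

/-- The event that the buses, started from their initial locations, are at `x` at time `t`. -/
def busesAt {Ω : Type*} {n : ℕ} (X : Fin n → ℝ≥0 → Ω → ℕ) (t : ℝ≥0) (x : Fin n → ℤ) : Set Ω :=
  {ω | ∀ i, walk X 0 (initial n) t i ω = x i}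

/-- `e^{-s} s^k / k!`, with the convention `1 / k! = 0` for negative `k`. -/
def poissonWeight (s : ℝ) (k : ℤ) : ℝ :=
  if 0 ≤ k then Real.exp (-s) * s ^ k.toNat / (Nat.factorial k.toNat : ℝ) else 0

/-- The binomial `(M, p)` weight at `k` (the weight of the Krawtchouk polynomials). -/
def binomialWeight (M : ℕ) (p : ℝ) (k : ℕ) : ℝ :=
  (Nat.choose M k : ℝ) * p ^ k * (1 - p) ^ (M - k)

/-- The product of `(y_j - y_i)²` over `i < j`. -/
def vandermondeSq {n : ℕ} (y : Fin n → ℕ) : ℝ :=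
  ∏ i : Fin n, ∏ j ∈ Finset.Ioi i, ((y j : ℝ) - (y i : ℝ)) ^ 2

open Classical in
/-- The configurations `M ≥ y_1 > ⋯ > y_n ≥ 0`. -/
def configurations (n M : ℕ) : Finset (Fin n → ℕ) :=
  (Fintype.piFinset fun _ => Finset.range (M + 1)).filter StrictAnti

/-- The Krawtchouk Unitary Ensemble: the orthogonal polynomial ensemble of `n` particles
with the binomial `(M, p)` weight, as a probability mass function on `configurations n M`. -/
def krawtchoukEnsemble (n M : ℕ) (p : ℝ) (y : Fin n → ℕ) : ℝ :=
  (vandermondeSq y * ∏ j, binomialWeight M p (y j)) /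
    ∑ z ∈ configurations n M, vandermondeSq z * ∏ j, binomialWeight M p (z j)

end BusModel

end

/-!
The fixed-time law of the bus model is a ratio of three non-intersection probabilities, each of
which is a determinant by the Karlin–McGregor formula; for Poisson weights with packed initial or
terminal positions the determinants are Vandermonde determinants, and their product gives the
squared Vandermonde factor of the Krawtchouk ensemble.

*Karlin–McGregor.* Instead of stopping at the first collision time, the argument runs along a grid
`τ 0 ≤ ⋯ ≤ τ m` of times. Let `A k` be the event that the walks are strictly decreasing (in the
Weyl chamber) at the times `τ 0, …, τ k`, and let `α k` be the signed sum over the permutations `σ`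
of the probabilities of `A k` and ending at `z ∘ σ`. Then `α 0` is the determinant, while `α m` is
the probability of `A m` and ending at `z`, because only the identity keeps the end point
decreasing. In passing from `k` to `k + 1`, the paths that are lost either sit at a common location
at time `τ (k + 1)`, and then their signed contributions cancel by the Markov property, a
determinant with two equal columns appearing (`sum_sign_mul_measureReal_collision`), or some walk
has moved by at least `2` in this step, which has probability `O((τ (k + 1) - τ k) ^ 2)`. These
errors sum up to `abs_det_sub_measureReal_gridChamber_le`, and vanish as the mesh goes to zero.
Right-continuity identifies the limit of the grid events with the event of remaining in the Weyl
chamber (`eventually_mem_gridChamber_iff`), which is almost surely the event of non-intersection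
(`measure_noIntersection_diff_inChamber`). This yields `measureReal_passage_eq_det`; the
independence of successive passages (`measureReal_passage_inter_passage`) is obtained by the same
approximation.

*Determinants.* Since `1 / (z - i)!` is `z (z - 1) ⋯ (z - i + 1) / z!`, a determinant with entries
`1 / (z_j - i)!` is a Vandermonde determinant up to the factors `1 / z_j!` (`det_poissonWeight`).
All determinants here take this form, some of them after reversing the order of rows and columns.
The normalization of the Krawtchouk ensemble needs no computation: the law of the buses has total
mass one.
-/

namespace BusModel

/-! ### Increments of independent Poisson processes -/

theorem IsPoissonProcess.measureReal_increment_eq {Ω : Type*} [MeasurableSpace Ω] {μ : Measure Ω}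
    {X : ℝ≥0 → Ω → ℕ} (hX : IsPoissonProcess 1 X μ) {s t : ℝ≥0} (hst : s ≤ t) (c : ℤ) :
    μ.real {ω | (X t ω : ℤ) - X s ω = c} = poissonWeight ((t : ℝ) - s) c := by
  unfold poissonWeight
  split_ifs with hc
  · lift c to ℕ using hc
    have : {ω | (X t ω : ℤ) - X s ω = c} = (fun ω => X t ω - X s ω) ⁻¹' {c} := by
      ext ω
      have : X s ω ≤ X t ω := hX.mono ω hst
      simp only [Set.mem_ofPred_eq, Set.mem_preimage, Set.mem_singleton_iff] at *
      omega
    have hm : Measurable fun ω => X t ω - X s ω := (hX.measurable t).sub (hX.measurable s)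
    rw [this, ← map_measureReal_apply hm (measurableSet_singleton _), hX.increments s t hst,
      poissonMeasure_real_singleton]
    simp [NNReal.coe_sub hst]
  · have : {ω | (X t ω : ℤ) - X s ω = c} = ∅ := by
      ext ω
      have : X s ω ≤ X t ω := hX.mono ω hst
      simp only [Set.mem_ofPred_eq, Set.mem_empty_iff_false, iff_false]
      omega
    simp [this]

/-- A Poisson variable of parameter `r` is at least `2` with probability `O(r²)`. -/
theorem IsPoissonProcess.measureReal_two_le_increment {Ω : Type*} [MeasurableSpace Ω]
    {μ : Measure Ω} [IsProbabilityMeasure μ]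
    {X : ℝ≥0 → Ω → ℕ} (hX : IsPoissonProcess 1 X μ) {s t : ℝ≥0} (hst : s ≤ t) :
    μ.real {ω | (2 : ℤ) ≤ (X t ω : ℤ) - X s ω} ≤ ((t : ℝ) - s) ^ 2 := by
  have hm : ∀ c : ℤ, MeasurableSet {ω | (X t ω : ℤ) - X s ω = c} := fun c => by
    have h1 := hX.measurable t
    have h2 := hX.measurable s
    measurability
  have hcompl : {ω | (2 : ℤ) ≤ (X t ω : ℤ) - X s ω} =
      ({ω | (X t ω : ℤ) - X s ω = 0} ∪ {ω | (X t ω : ℤ) - X s ω = 1})ᶜ := by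
    ext ω
    have : X s ω ≤ X t ω := hX.mono ω hst
    simp only [Set.mem_ofPred_eq, Set.mem_compl_iff, Set.mem_union] at *
    omega
  have hdisj : Disjoint {ω | (X t ω : ℤ) - X s ω = 0} {ω | (X t ω : ℤ) - X s ω = 1} := by
    rw [Set.disjoint_left]
    intro ω h1 h2
    simp only [Set.mem_ofPred_eq] at *
    omega
  rw [hcompl, probReal_compl_eq_one_sub ((hm 0).union (hm 1)),
    measureReal_union hdisj (hm 1), hX.measureReal_increment_eq hst,
    hX.measureReal_increment_eq hst]
  have h0 : (0 : ℝ) ≤ (t : ℝ) - s := sub_nonneg.2 hst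
  simp only [poissonWeight, le_refl, if_true, zero_le_one, Int.toNat_zero, Int.toNat_one, pow_zero,
    pow_one, Nat.factorial, Nat.cast_one, div_one, mul_one, Nat.succ_eq_add_one, zero_add]
  have := Real.one_sub_le_exp_neg ((t : ℝ) - s)
  nlinarith

theorem measurable_increment {Ω : Type*} [MeasurableSpace Ω] {μ : Measure Ω} {n : ℕ}
    {X : Fin n → ℝ≥0 → Ω → ℕ} (hX : ∀ i, IsPoissonProcess 1 (X i) μ) (s t : ℝ≥0) (i : Fin n) :
    Measurable fun ω => (X i t ω : ℤ) - X i s ω := by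
  have h1 := (hX i).measurable t
  have h2 := (hX i).measurable s
  exact (Measurable.of_discrete.comp h1).sub (Measurable.of_discrete.comp h2)

theorem measureReal_increments_eq {Ω : Type*} [MeasurableSpace Ω] {μ : Measure Ω} {n : ℕ}
    {X : Fin n → ℝ≥0 → Ω → ℕ} (hX : ∀ i, IsPoissonProcess 1 (X i) μ)
    (hindep : iIndepFun (fun i ω s => X i s ω) μ) {s t : ℝ≥0} (hst : s ≤ t) (c : Fin n → ℤ) :
    μ.real {ω | ∀ i, (X i t ω : ℤ) - X i s ω = c i} =
      ∏ i, poissonWeight ((t : ℝ) - s) (c i) := by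
  have h := hindep.comp (fun _ path => (path t : ℤ) - path s) (fun _ => by fun_prop)
  have h' := h.measure_inter_preimage_eq_mul Finset.univ (sets := fun i => {c i})
    (fun i _ => measurableSet_singleton _)
  have e : {ω | ∀ i, (X i t ω : ℤ) - X i s ω = c i} = ⋂ i ∈ Finset.univ,
      ((fun path : ℝ≥0 → ℕ => (path t : ℤ) - path s) ∘ fun ω s => X i s ω) ⁻¹' {c i} := by
    ext ω; simp
  rw [e, measureReal_def, h', ENNReal.toReal_prod]
  exact Finset.prod_congr rfl fun i _ => (hX i).measureReal_increment_eq hst (c i)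

theorem iIndepFun_increments {Ω : Type*} [MeasurableSpace Ω] {μ : Measure Ω} {n : ℕ}
    {X : Fin n → ℝ≥0 → Ω → ℕ} (hX : ∀ i, IsPoissonProcess 1 (X i) μ)
    (hindep : iIndepFun (fun i ω s => X i s ω) μ) {τ : ℕ → ℝ≥0} (hτ : Monotone τ) :
    iIndepFun (fun (q : Fin n × ℕ) ω => X q.1 (τ (q.2 + 1)) ω - X q.1 (τ q.2) ω) μ :=
  iIndepFun_uncurry' (X := fun i k ω => X i (τ (k + 1)) ω - X i (τ k) ω)
    (fun i k => ((hX i).measurable _).sub ((hX i).measurable _))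
    (hindep.comp (fun _ path k => path (τ (k + 1)) - path (τ k)) (fun _ => by fun_prop))
    (fun i => (hX i).indepIncrements.nat hτ)

/-- Along a monotone sequence of times, the increments up to the `k`-th time are independent of
the increments from the `k`-th time on. -/
theorem indepFun_past_future {Ω : Type*} [MeasurableSpace Ω] {μ : Measure Ω} {n : ℕ}
    {X : Fin n → ℝ≥0 → Ω → ℕ} (hX : ∀ i, IsPoissonProcess 1 (X i) μ)
    (hindep : iIndepFun (fun i ω s => X i s ω) μ) {τ : ℕ → ℝ≥0} (hτ : Monotone τ) (k l : ℕ) :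
    IndepFun
      (fun ω (q : Fin n × Fin (k + 1)) => (X q.1 (τ q.2) ω : ℤ) - X q.1 (τ 0) ω)
      (fun ω (q : Fin n × Fin (l + 1)) => (X q.1 (τ (k + q.2)) ω : ℤ) - X q.1 (τ k) ω) μ := by
  have h := (iIndepFun_increments hX hindep hτ).indepFun_finset
    (Finset.univ ×ˢ Finset.range k) (Finset.univ ×ˢ Finset.Ico k (k + l))
    (by
      rw [Finset.disjoint_left]
      rintro ⟨i, j⟩ h1 h2
      simp only [Finset.mem_product, Finset.mem_range, Finset.mem_Ico] at h1 h2
      omega)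
    (fun q => ((hX q.1).measurable _).sub ((hX q.1).measurable _))
  have h' := h.comp
    (φ := fun d (q : Fin n × Fin (k + 1)) => ∑ j ∈ Finset.range q.2,
      (if hj : (q.1, j) ∈ Finset.univ ×ˢ Finset.range k then (d ⟨(q.1, j), hj⟩ : ℤ) else 0))
    (ψ := fun d (q : Fin n × Fin (l + 1)) => ∑ j ∈ Finset.range q.2,
      (if hj : (q.1, k + j) ∈ Finset.univ ×ˢ Finset.Ico k (k + l)
        then (d ⟨(q.1, k + j), hj⟩ : ℤ) else 0))
    Measurable.of_discrete Measurable.of_discrete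
  convert! h' using 1
  · funext ω q
    have hq := q.2.2
    simp only [Function.comp_apply]
    rw [← Finset.sum_range_sub (fun j => (X q.1 (τ j) ω : ℤ))]
    refine Finset.sum_congr rfl fun j hj => ?_
    rw [Finset.mem_range] at hj
    rw [dif_pos (by simp; omega), Nat.cast_sub ((hX q.1).mono ω (hτ (Nat.le_succ j)))]
  · funext ω q
    have hq := q.2.2
    simp only [Function.comp_apply]
    have e := Finset.sum_range_sub (fun j => (X q.1 (τ (k + j)) ω : ℤ)) q.2
    rw [add_zero] at e
    rw [← e]
    refine Finset.sum_congr rfl fun j hj => ?_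
    rw [Finset.mem_range] at hj
    rw [dif_pos (by simp; omega), Nat.cast_sub ((hX q.1).mono ω (hτ (Nat.le_succ _)))]
    rfl

/-! ### The Karlin–McGregor formula on a grid of times -/

theorem hasSum_measureReal_inter_preimage_singleton {Ω β : Type*} [MeasurableSpace Ω]
    {μ : Measure Ω} [IsFiniteMeasure μ] [Countable β] [MeasurableSpace β]
    [MeasurableSingletonClass β] {f : Ω → β} (hf : Measurable f) {E : Set Ω}
    (hE : MeasurableSet E) :
    HasSum (fun v => μ.real (E ∩ f ⁻¹' {v})) (μ.real E) := by
  have hU : E = ⋃ v, E ∩ f ⁻¹' {v} := by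
    ext ω; simp
  have hsum : μ E = ∑' v, μ (E ∩ f ⁻¹' {v}) := by
    conv_lhs => rw [hU]
    refine measure_iUnion (fun v w hvw => ?_) fun v => hE.inter (hf (measurableSet_singleton v))
    refine Set.disjoint_left.2 ?_
    rintro ω ⟨-, h1⟩ ⟨-, h2⟩
    exact hvw (h1.symm.trans h2)
  have hne : ∑' v, μ (E ∩ f ⁻¹' {v}) ≠ ⊤ := hsum ▸ measure_ne_top μ E
  have := ENNReal.hasSum_toReal hne
  rw [← ENNReal.tsum_toReal_eq (fun v => measure_ne_top μ _), ← hsum] at this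
  exact this

/-- The event that the walks started from `a` at time `τ 0` are in the Weyl chamber of strictly
decreasing configurations at the times `τ 0, …, τ k`. -/
def gridChamber {Ω : Type*} {n : ℕ} (X : Fin n → ℝ≥0 → Ω → ℕ) (τ : ℕ → ℝ≥0) (a : Fin n → ℤ)
    (k : ℕ) : Set Ω :=
  {ω | ∀ j ≤ k, StrictAnti fun i => walk X (τ 0) a (τ j) i ω}

/-- The event that the walks started from `a` at time `s` are at `b` at time `t`, whether or not
they met before. -/
def endsAt {Ω : Type*} {n : ℕ} (X : Fin n → ℝ≥0 → Ω → ℕ) (s : ℝ≥0) (a : Fin n → ℤ)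
    (t : ℝ≥0) (b : Fin n → ℤ) : Set Ω :=
  {ω | ∀ i, walk X s a t i ω = b i}

/-- The event that some walk moves by at least `2` between the times `s` and `t`. -/
def bigStep {Ω : Type*} {n : ℕ} (X : Fin n → ℝ≥0 → Ω → ℕ) (s t : ℝ≥0) : Set Ω :=
  {ω | ∃ i, (2 : ℤ) ≤ (X i t ω : ℤ) - X i s ω}

theorem measurable_walk {Ω : Type*} [MeasurableSpace Ω] {μ : Measure Ω} {n : ℕ}
    {X : Fin n → ℝ≥0 → Ω → ℕ} (hX : ∀ i, IsPoissonProcess 1 (X i) μ)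
    (s t : ℝ≥0) (a : Fin n → ℤ) :
    Measurable fun ω i => walk X s a t i ω :=
  measurable_pi_lambda _ fun i => (measurable_increment hX s t i).const_add (a i)

theorem measurableSet_endsAt {Ω : Type*} [MeasurableSpace Ω] {μ : Measure Ω} {n : ℕ}
    {X : Fin n → ℝ≥0 → Ω → ℕ} (hX : ∀ i, IsPoissonProcess 1 (X i) μ)
    (s t : ℝ≥0) (a b : Fin n → ℤ) :
    MeasurableSet (endsAt X s a t b) := by
  have : endsAt X s a t b = (fun ω i => walk X s a t i ω) ⁻¹' {b} := by
    ext ω; simp [endsAt, funext_iff]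
  rw [this]
  exact measurable_walk hX s t a (measurableSet_singleton _)

theorem measurableSet_gridChamber {Ω : Type*} [MeasurableSpace Ω] {μ : Measure Ω} {n : ℕ}
    {X : Fin n → ℝ≥0 → Ω → ℕ} (hX : ∀ i, IsPoissonProcess 1 (X i) μ)
    (τ : ℕ → ℝ≥0) (a : Fin n → ℤ) (k : ℕ) :
    MeasurableSet (gridChamber X τ a k) := by
  have : gridChamber X τ a k =
      ⋂ j ≤ k, (fun ω i => walk X (τ 0) a (τ j) i ω) ⁻¹' {v | StrictAnti v} := by
    ext ω; simp [gridChamber]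
  rw [this]
  exact MeasurableSet.iInter fun j => MeasurableSet.iInter fun _ =>
    measurable_walk hX _ _ a (Set.to_countable _).measurableSet

theorem measureReal_bigStep_le {Ω : Type*} [MeasurableSpace Ω] {μ : Measure Ω}
    [IsProbabilityMeasure μ] {n : ℕ}
    {X : Fin n → ℝ≥0 → Ω → ℕ} (hX : ∀ i, IsPoissonProcess 1 (X i) μ)
    {s t : ℝ≥0} (hst : s ≤ t) :
    μ.real (bigStep X s t) ≤ n * ((t : ℝ) - s) ^ 2 := by
  have : bigStep X s t = ⋃ i, {ω | (2 : ℤ) ≤ (X i t ω : ℤ) - X i s ω} := by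
    ext ω; simp [bigStep]
  rw [this]
  calc _ ≤ ∑ i, μ.real {ω | (2 : ℤ) ≤ (X i t ω : ℤ) - X i s ω} := measureReal_iUnion_fintype_le _
    _ ≤ ∑ _i : Fin n, ((t : ℝ) - s) ^ 2 :=
      Finset.sum_le_sum fun i _ => (hX i).measureReal_two_le_increment hst
    _ = n * ((t : ℝ) - s) ^ 2 := by simp

/-- Walks that move by at most `1` cannot leave the Weyl chamber without being at the same
location. -/
theorem strictAnti_walk_of_injective {Ω : Type*} [MeasurableSpace Ω] {μ : Measure Ω} {n : ℕ}
    {X : Fin n → ℝ≥0 → Ω → ℕ} (hX : ∀ i, IsPoissonProcess 1 (X i) μ)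
    {s t u : ℝ≥0} (htu : t ≤ u) {a : Fin n → ℤ} {ω : Ω}
    (h : StrictAnti fun i => walk X s a t i ω) (hstep : ω ∉ bigStep X t u)
    (hinj : Function.Injective fun i => walk X s a u i ω) :
    StrictAnti fun i => walk X s a u i ω := by
  intro i j hij
  have h1 := h hij
  have h2 : walk X s a u i ω ≠ walk X s a u j ω := fun e => hij.ne (hinj e)
  have h3 : X i t ω ≤ X i u ω := (hX i).mono ω htu
  have h4 : ¬ (2 : ℤ) ≤ (X j u ω : ℤ) - X j t ω := fun hj => hstep ⟨j, hj⟩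
  simp only [walk] at *
  omega

theorem measureReal_endsAt {Ω : Type*} [MeasurableSpace Ω] {μ : Measure Ω} {n : ℕ}
    {X : Fin n → ℝ≥0 → Ω → ℕ} (hX : ∀ i, IsPoissonProcess 1 (X i) μ)
    (hindep : iIndepFun (fun i ω s => X i s ω) μ)
    {s t : ℝ≥0} (hst : s ≤ t) (a b : Fin n → ℤ) :
    μ.real (endsAt X s a t b) = ∏ i, poissonWeight ((t : ℝ) - s) (b i - a i) := by
  rw [← measureReal_increments_eq hX hindep hst]
  congr 1
  ext ω
  simp only [endsAt, walk, Set.mem_ofPred_eq]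
  exact forall_congr' fun i => by omega

/-- Markov property on a grid: given the position `v` at the `k`-th time, the walks forget
the event `A` on the increments before. -/
theorem measureReal_past_inter_endsAt {Ω : Type*} [MeasurableSpace Ω] {μ : Measure Ω} {n : ℕ}
    {X : Fin n → ℝ≥0 → Ω → ℕ} (hX : ∀ i, IsPoissonProcess 1 (X i) μ)
    (hindep : iIndepFun (fun i ω s => X i s ω) μ)
    {τ : ℕ → ℝ≥0} (hτ : Monotone τ) (a v c : Fin n → ℤ)
    (k l : ℕ) (A : Set (Fin n × Fin (k + 1) → ℤ)) :
    μ.real (((fun ω (q : Fin n × Fin (k + 1)) => (X q.1 (τ q.2) ω : ℤ) - X q.1 (τ 0) ω) ⁻¹' A ∩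
        endsAt X (τ 0) a (τ (k + l)) c) ∩ (fun ω i => walk X (τ 0) a (τ k) i ω) ⁻¹' {v}) =
      μ.real ((fun ω (q : Fin n × Fin (k + 1)) => (X q.1 (τ q.2) ω : ℤ) - X q.1 (τ 0) ω) ⁻¹' A ∩
        (fun ω i => walk X (τ 0) a (τ k) i ω) ⁻¹' {v}) *
      ∏ i, poissonWeight ((τ (k + l) : ℝ) - τ k) (c i - v i) := by
  have h := (indepFun_past_future hX hindep hτ k l).measure_inter_preimage_eq_mul
    (A ∩ {d | ∀ i, a i + d (i, Fin.last k) = v i})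
    {d | ∀ i, v i + d (i, Fin.last l) = c i}
    (Set.to_countable _).measurableSet (Set.to_countable _).measurableSet
  have h' := congrArg ENNReal.toReal h
  rw [ENNReal.toReal_mul] at h'
  simp only [← measureReal_def] at h'
  rw [← measureReal_endsAt hX hindep (hτ (Nat.le_add_right k l))]
  have e1 : (fun ω (q : Fin n × Fin (k + 1)) => (X q.1 (τ q.2) ω : ℤ) - X q.1 (τ 0) ω) ⁻¹' A ∩
      (fun ω i => walk X (τ 0) a (τ k) i ω) ⁻¹' {v} =
      (fun ω (q : Fin n × Fin (k + 1)) => (X q.1 (τ q.2) ω : ℤ) - X q.1 (τ 0) ω) ⁻¹'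
        (A ∩ {d | ∀ i, a i + d (i, Fin.last k) = v i}) := by
    ext ω
    simp only [walk, Set.mem_inter_iff, Set.mem_preimage, Set.mem_singleton_iff,
      Set.mem_ofPred_eq, Fin.val_last, funext_iff]
  have e2 : endsAt X (τ k) v (τ (k + l)) c =
      (fun ω (q : Fin n × Fin (l + 1)) => (X q.1 (τ (k + q.2)) ω : ℤ) - X q.1 (τ k) ω) ⁻¹'
        {d | ∀ i, v i + d (i, Fin.last l) = c i} := by
    ext ω
    simp only [endsAt, walk, Set.mem_preimage, Set.mem_ofPred_eq, Fin.val_last]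
  rw [e2, e1, ← h', ← e1, ← e2]
  congr 1
  ext ω
  simp only [endsAt, walk, Set.mem_inter_iff, Set.mem_preimage, Set.mem_singleton_iff,
    Set.mem_ofPred_eq, funext_iff]
  constructor
  · rintro ⟨⟨h1, h2⟩, h3⟩
    exact ⟨⟨h1, h3⟩, fun i => by have := h2 i; have := h3 i; omega⟩
  · rintro ⟨⟨h1, h3⟩, h2⟩
    exact ⟨⟨h1, fun i => by have := h2 i; have := h3 i; omega⟩, h3⟩

/-- The reflection principle behind the Karlin–McGregor formula: on an event which depends on the
increments up to the `k`-th time and on which two walks are then at the same location, the signed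
sum over all permutations of the end points cancels, being a combination of determinants with two
equal columns. -/
theorem sum_sign_mul_measureReal_collision {Ω : Type*} [MeasurableSpace Ω] {μ : Measure Ω}
    [IsProbabilityMeasure μ] {n : ℕ}
    {X : Fin n → ℝ≥0 → Ω → ℕ} (hX : ∀ i, IsPoissonProcess 1 (X i) μ)
    (hindep : iIndepFun (fun i ω s => X i s ω) μ)
    {τ : ℕ → ℝ≥0} (hτ : Monotone τ) (a z : Fin n → ℤ)
    (k l : ℕ) (A : Set (Fin n × Fin (k + 1) → ℤ))
    (hA : ∀ d ∈ A, ¬ Function.Injective fun i => a i + d (i, Fin.last k)) :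
    ∑ σ : Equiv.Perm (Fin n), ((Equiv.Perm.sign σ : ℤ) : ℝ) *
      μ.real ((fun ω (q : Fin n × Fin (k + 1)) => (X q.1 (τ q.2) ω : ℤ) - X q.1 (τ 0) ω) ⁻¹' A ∩
        endsAt X (τ 0) a (τ (k + l)) (z ∘ σ)) = 0 := by
  set Y : Ω → Fin n × Fin (k + 1) → ℤ :=
    fun ω q => (X q.1 (τ q.2) ω : ℤ) - X q.1 (τ 0) ω with hYdef
  have hY : Measurable Y := measurable_pi_lambda _ fun q => measurable_increment hX _ _ _
  have hYA : MeasurableSet (Y ⁻¹' A) := hY (Set.to_countable _).measurableSet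
  have hS := measurable_walk hX (τ 0) (τ k) a
  have hsum := hasSum_sum (s := Finset.univ) fun (σ : Equiv.Perm (Fin n)) _ =>
    (hasSum_measureReal_inter_preimage_singleton (μ := μ) hS
      (hYA.inter (measurableSet_endsAt hX (τ 0) (τ (k + l)) a (z ∘ σ)))).mul_left
      ((Equiv.Perm.sign σ : ℤ) : ℝ)
  refine hsum.unique ?_
  convert! hasSum_zero using 2 with v
  simp only [hYdef, measureReal_past_inter_endsAt hX hindep hτ a v _ k l A]
  by_cases hv : Function.Injective v
  · have : (Y ⁻¹' A) ∩ (fun ω i => walk X (τ 0) a (τ k) i ω) ⁻¹' {v} = ∅ := by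
      ext ω
      simp only [Set.mem_inter_iff, Set.mem_preimage, Set.mem_singleton_iff,
        Set.mem_empty_iff_false, iff_false, not_and]
      rintro h1 rfl
      exact hA _ h1 hv
    simp [← hYdef, this]
  · simp only [Function.Injective, not_forall] at hv
    obtain ⟨i, j, hij, hne⟩ := hv
    have hdet : Matrix.det (Matrix.of fun r c : Fin n =>
        poissonWeight ((τ (k + l) : ℝ) - τ k) (z r - v c)) = 0 :=
      Matrix.det_zero_of_column_eq hne fun r => by simp [hij]
    rw [Matrix.det_apply'] at hdet
    simp only [Matrix.of_apply] at hdet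
    simp only [Function.comp_apply, mul_left_comm ((_ : ℤ) : ℝ), ← Finset.mul_sum, hdet, mul_zero]

/-- Checking the Weyl chamber at one more time of the grid changes the signed sum only by the
probability of a step of size at least `2`: the remaining lost paths have two walks at the same
location and cancel. -/
theorem abs_sum_sign_mul_measureReal_sub_le {Ω : Type*} [MeasurableSpace Ω] {μ : Measure Ω}
    [IsProbabilityMeasure μ] {n : ℕ}
    {X : Fin n → ℝ≥0 → Ω → ℕ} (hX : ∀ i, IsPoissonProcess 1 (X i) μ)
    (hindep : iIndepFun (fun i ω s => X i s ω) μ)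
    {τ : ℕ → ℝ≥0} (hτ : Monotone τ) (a z : Fin n → ℤ)
    (k l : ℕ) :
    |∑ σ : Equiv.Perm (Fin n), ((Equiv.Perm.sign σ : ℤ) : ℝ) *
        μ.real (gridChamber X τ a k ∩ endsAt X (τ 0) a (τ (k + 1 + l)) (z ∘ σ)) -
      ∑ σ : Equiv.Perm (Fin n), ((Equiv.Perm.sign σ : ℤ) : ℝ) *
        μ.real (gridChamber X τ a (k + 1) ∩ endsAt X (τ 0) a (τ (k + 1 + l)) (z ∘ σ))| ≤
      n.factorial * μ.real (bigStep X (τ k) (τ (k + 1))) := by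
  -- the paths with a collision at the new time, whose signed sum cancels
  set C : Set Ω := {ω | ¬ Function.Injective fun i => walk X (τ 0) a (τ (k + 1)) i ω} with hC
  have hCm : MeasurableSet C :=
    measurable_walk hX (τ 0) (τ (k + 1)) a
      (Set.to_countable {v | ¬ Function.Injective v}).measurableSet
  have hcancel := sum_sign_mul_measureReal_collision hX hindep hτ a z (k + 1) l
    {d | (∀ j : Fin (k + 1), StrictAnti fun i => a i + d (i, j.castSucc)) ∧
      ¬ Function.Injective fun i => a i + d (i, Fin.last (k + 1))} (fun d hd => hd.2)
  have hset : (fun ω (q : Fin n × Fin (k + 1 + 1)) => (X q.1 (τ q.2) ω : ℤ) - X q.1 (τ 0) ω) ⁻¹'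
      {d | (∀ j : Fin (k + 1), StrictAnti fun i => a i + d (i, j.castSucc)) ∧
      ¬ Function.Injective fun i => a i + d (i, Fin.last (k + 1))} = gridChamber X τ a k ∩ C := by
    ext ω
    simp only [gridChamber, C, walk, Set.mem_preimage, Set.mem_inter_iff, Set.mem_ofPred_eq,
      Fin.val_castSucc, Fin.val_last, Fin.forall_iff, Nat.lt_succ_iff]
  rw [hset] at hcancel
  have hσ : ∀ σ : Equiv.Perm (Fin n),
      |μ.real (gridChamber X τ a k ∩ endsAt X (τ 0) a (τ (k + 1 + l)) (z ∘ σ)) -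
        μ.real (gridChamber X τ a k ∩ C ∩ endsAt X (τ 0) a (τ (k + 1 + l)) (z ∘ σ)) -
        μ.real (gridChamber X τ a (k + 1) ∩ endsAt X (τ 0) a (τ (k + 1 + l)) (z ∘ σ))| ≤
      μ.real (bigStep X (τ k) (τ (k + 1))) := by
    intro σ
    set H := endsAt X (τ 0) a (τ (k + 1 + l)) (z ∘ σ)
    have e : μ.real (gridChamber X τ a k ∩ H) = μ.real (gridChamber X τ a k ∩ C ∩ H) +
        μ.real ((gridChamber X τ a k ∩ H) \ C) := by
      rw [← measureReal_inter_add_sdiff (s := gridChamber X τ a k ∩ H) hCm, Set.inter_right_comm]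
    have h1 : μ.real (gridChamber X τ a (k + 1) ∩ H) ≤
        μ.real ((gridChamber X τ a k ∩ H) \ C) := by
      refine measureReal_mono ?_
      rintro ω ⟨h1, h2⟩
      exact ⟨⟨fun j hj => h1 j (hj.trans (Nat.le_succ k)), h2⟩,
        fun hc => hc (h1 _ le_rfl).injective⟩
    have h2 : μ.real ((gridChamber X τ a k ∩ H) \ C) ≤
        μ.real (gridChamber X τ a (k + 1) ∩ H) + μ.real (bigStep X (τ k) (τ (k + 1))) := by
      refine (measureReal_mono ?_).trans (measureReal_union_le _ _)
      rintro ω ⟨⟨h1, h2⟩, h3⟩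
      by_cases hb : ω ∈ bigStep X (τ k) (τ (k + 1))
      · exact Or.inr hb
      · refine Or.inl ⟨fun j hj => ?_, h2⟩
        rcases Nat.le_succ_iff.1 hj with hj | rfl
        · exact h1 j hj
        · exact strictAnti_walk_of_injective hX (hτ (Nat.le_succ k)) (h1 k le_rfl) hb
            (not_not.1 h3)
    rw [abs_le]
    constructor <;> linarith
  rw [← Finset.sum_sub_distrib, ← sub_zero (Finset.sum _ _), ← hcancel, ← Finset.sum_sub_distrib]
  calc _ ≤ ∑ σ : Equiv.Perm (Fin n), μ.real (bigStep X (τ k) (τ (k + 1))) := by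
        refine (Finset.abs_sum_le_sum_abs _ _).trans (Finset.sum_le_sum fun σ _ => ?_)
        rw [← mul_sub, ← mul_sub, abs_mul, sub_right_comm]
        refine (mul_le_of_le_one_left (abs_nonneg _) ?_).trans (hσ σ)
        rcases Int.units_eq_one_or (Equiv.Perm.sign σ) with h | h <;> simp [h]
    _ = _ := by simp [Fintype.card_perm]

/-- The Karlin–McGregor formula on a grid, up to the probability of steps of size at least `2`. -/
theorem abs_det_sub_measureReal_gridChamber_le {Ω : Type*} [MeasurableSpace Ω] {μ : Measure Ω}
    [IsProbabilityMeasure μ] {n : ℕ}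
    {X : Fin n → ℝ≥0 → Ω → ℕ} (hX : ∀ i, IsPoissonProcess 1 (X i) μ)
    (hindep : iIndepFun (fun i ω s => X i s ω) μ)
    {τ : ℕ → ℝ≥0} (hτ : Monotone τ)
    {a z : Fin n → ℤ} (ha : StrictAnti a) (hz : StrictAnti z) (m : ℕ) :
    |Matrix.det (Matrix.of fun i j : Fin n => poissonWeight ((τ m : ℝ) - τ 0) (z i - a j)) -
      μ.real (gridChamber X τ a m ∩ endsAt X (τ 0) a (τ m) z)| ≤
      n.factorial * ∑ k ∈ Finset.range m, μ.real (bigStep X (τ k) (τ (k + 1))) := by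
  set α : ℕ → ℝ := fun k => ∑ σ : Equiv.Perm (Fin n), ((Equiv.Perm.sign σ : ℤ) : ℝ) *
    μ.real (gridChamber X τ a k ∩ endsAt X (τ 0) a (τ m) (z ∘ σ)) with hα
  have h0 : Matrix.det (Matrix.of fun i j : Fin n =>
      poissonWeight ((τ m : ℝ) - τ 0) (z i - a j)) = α 0 := by
    rw [Matrix.det_apply']
    refine Finset.sum_congr rfl fun σ _ => ?_
    have : gridChamber X τ a 0 = Set.univ := by
      ext ω
      simpa [gridChamber, walk] using ha
    rw [this, Set.univ_inter, measureReal_endsAt hX hindep (hτ (Nat.zero_le m))]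
    rfl
  have hm : μ.real (gridChamber X τ a m ∩ endsAt X (τ 0) a (τ m) z) = α m := by
    rw [hα]
    simp only
    -- a permutation that keeps `z` strictly decreasing is increasing, hence the identity
    rw [Finset.sum_eq_single_of_mem 1 (Finset.mem_univ _)]
    · simp
    · intro σ _ hσ
      have : gridChamber X τ a m ∩ endsAt X (τ 0) a (τ m) (z ∘ σ) = ∅ := by
        ext ω
        simp only [Set.mem_inter_iff, Set.mem_empty_iff_false, iff_false, not_and]
        intro h1 h2
        have h3 : StrictAnti (z ∘ σ) := by
          have h4 := h1 m le_rfl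
          rwa [show (fun i => walk X (τ 0) a (τ m) i ω) = z ∘ σ from funext h2] at h4
        have h5 : StrictMono σ := fun i j hij => hz.lt_iff_gt.1 (h3 hij)
        refine hσ (Equiv.ext fun i => ?_)
        exact congrFun (Subsingleton.elim (h5.orderIsoOfSurjective σ σ.surjective)
          (OrderIso.refl _) |> congrArg DFunLike.coe) i
      simp [this]
  have htel : α 0 - α m = ∑ k ∈ Finset.range m, (α k - α (k + 1)) :=
    (Finset.sum_range_sub' α m).symm
  rw [h0, hm, htel, Finset.mul_sum]
  refine (Finset.abs_sum_le_sum_abs _ _).trans (Finset.sum_le_sum fun k hk => ?_)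
  obtain ⟨l, rfl⟩ : ∃ l, m = k + 1 + l := Nat.exists_eq_add_of_le (Finset.mem_range.1 hk)
  exact abs_sum_sign_mul_measureReal_sub_le hX hindep hτ a z k l

/-! ### Refining the grid -/

section

open Filter Topology

/-- The uniform grid on `[s, t]` with `m + 1` steps. -/
noncomputable def grid (s t : ℝ≥0) (m j : ℕ) : ℝ≥0 := s + j * ((t - s) / (m + 1))

theorem grid_zero (s t : ℝ≥0) (m : ℕ) : grid s t m 0 = s := by simp [grid]

theorem grid_last {s t : ℝ≥0} (hst : s ≤ t) (m : ℕ) : grid s t m (m + 1) = t := by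
  have h : ((m : ℝ≥0) + 1) ≠ 0 := by positivity
  rw [grid, Nat.cast_add, Nat.cast_one, mul_div_cancel₀ _ h, add_tsub_cancel_of_le hst]

theorem grid_monotone (s t : ℝ≥0) (m : ℕ) : Monotone (grid s t m) := by
  intro i j hij
  unfold grid
  gcongr

theorem coe_grid {s t : ℝ≥0} (hst : s ≤ t) (m j : ℕ) :
    (grid s t m j : ℝ) = s + j * (((t : ℝ) - s) / (m + 1)) := by
  simp [grid, NNReal.coe_sub hst]

theorem tendsto_const_div_add_one (c : ℝ) :
    Tendsto (fun m : ℕ => c / ((m : ℝ) + 1)) atTop (𝓝 0) := by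
  simpa [div_eq_mul_inv] using (tendsto_one_div_add_atTop_nhds_zero_nat (𝕜 := ℝ)).const_mul c

/-- The event that the walks started from `a` at time `s` are in the Weyl chamber of strictly
decreasing configurations during `[s, t]`. -/
def inChamber {Ω : Type*} {n : ℕ} (X : Fin n → ℝ≥0 → Ω → ℕ) (s : ℝ≥0) (a : Fin n → ℤ)
    (t : ℝ≥0) : Set Ω :=
  {ω | ∀ u ∈ Set.Icc s t, StrictAnti fun i => walk X s a u i ω}

/-- Since the paths are right-continuous, an exit from the Weyl chamber is seen by all
sufficiently fine grids. -/
theorem eventually_mem_gridChamber_iff {Ω : Type*} [MeasurableSpace Ω] {μ : Measure Ω} {n : ℕ}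
    {X : Fin n → ℝ≥0 → Ω → ℕ} (hX : ∀ i, IsPoissonProcess 1 (X i) μ)
    {s t : ℝ≥0} (hst : s ≤ t) (a : Fin n → ℤ) (ω : Ω) :
    ∀ᶠ m : ℕ in atTop, ω ∈ gridChamber X (grid s t m) a (m + 1) ↔ ω ∈ inChamber X s a t := by
  by_cases h : ω ∈ inChamber X s a t
  · refine Eventually.of_forall fun m => iff_of_true (fun j hj => ?_) h
    rw [grid_zero]
    refine h _ ⟨?_, ?_⟩
    · exact (grid_zero s t m).symm.le.trans (grid_monotone s t m (Nat.zero_le j))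
    · exact (grid_monotone s t m hj).trans (grid_last hst m).le
  · have h' := h
    simp only [inChamber, Set.mem_ofPred_eq, not_forall] at h'
    obtain ⟨u, ⟨hsu, hut⟩, hu⟩ := h'
    suffices H : ∀ᶠ m : ℕ in atTop, ∃ j ≤ m + 1, ∀ i, X i (grid s t m j) ω = X i u ω by
      filter_upwards [H] with m ⟨j, hj, hjX⟩
      refine iff_of_false (fun hm => hu ?_) h
      have := hm j hj
      simpa only [walk, grid_zero, hjX] using this
    rcases hut.eq_or_lt with rfl | hut
    · exact Eventually.of_forall fun m => ⟨m + 1, le_rfl, fun i => by rw [grid_last hst]⟩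
    have hc : ∀ᶠ r in 𝓝[≥] u, ∀ i, X i r ω = X i u ω := by
      refine eventually_all.2 fun i => ?_
      have := (hX i).rightCont ω u
      rw [ContinuousWithinAt, nhds_discrete, tendsto_pure] at this
      exact this
    obtain ⟨v, huv, hv⟩ := mem_nhdsGE_iff_exists_Ico_subset.1 hc
    have huv' : (0 : ℝ) < (v : ℝ) - u := sub_pos.2 huv
    filter_upwards [(tendsto_const_div_add_one ((t : ℝ) - s)).eventually_lt_const huv'] with m hm
    have hpos : 0 < ((t : ℝ) - s) / (m + 1) :=
      div_pos (sub_pos.2 (lt_of_le_of_lt hsu hut)) (by positivity)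
    set d := ((t : ℝ) - s) / (m + 1) with hd
    have hus : (0 : ℝ) ≤ (u : ℝ) - s := sub_nonneg.2 hsu
    refine ⟨⌈((u : ℝ) - s) / d⌉₊, ?_, ?_⟩
    · refine Nat.ceil_le.2 ?_
      rw [div_le_iff₀ hpos, hd]
      have : (((m + 1 : ℕ) : ℝ)) * (((t : ℝ) - s) / (m + 1)) = t - s := by
        push_cast; field_simp
      rw [this]
      have : (u : ℝ) < t := hut
      linarith
    · have h1 := Nat.le_ceil (((u : ℝ) - s) / d)
      have h2 := Nat.ceil_lt_add_one (div_nonneg hus hpos.le)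
      rw [div_le_iff₀ hpos] at h1
      have h3 := mul_lt_mul_of_pos_right h2 hpos
      rw [add_mul, div_mul_cancel₀ _ hpos.ne', one_mul] at h3
      refine hv ⟨?_, ?_⟩
      · rw [← NNReal.coe_le_coe, coe_grid hst, ← hd]
        linarith
      · rw [← NNReal.coe_lt_coe, coe_grid hst, ← hd]
        linarith

/-- Walks that do not intersect and make only small steps along a grid are in the Weyl chamber at
all times of the grid. -/
theorem noIntersection_subset_gridChamber_union {Ω : Type*} [MeasurableSpace Ω] {μ : Measure Ω}
    {n : ℕ} {X : Fin n → ℝ≥0 → Ω → ℕ} (hX : ∀ i, IsPoissonProcess 1 (X i) μ)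
    {τ : ℕ → ℝ≥0} (hτ : Monotone τ) {a : Fin n → ℤ} (ha : StrictAnti a) (m : ℕ) :
    noIntersection X (τ 0) a (τ m) ⊆
      gridChamber X τ a m ∪ ⋃ k ∈ Finset.range m, bigStep X (τ k) (τ (k + 1)) := by
  intro ω hω
  by_cases hb : ω ∈ ⋃ k ∈ Finset.range m, bigStep X (τ k) (τ (k + 1))
  · exact Or.inr hb
  refine Or.inl fun j => ?_
  simp only [Set.mem_iUnion, Finset.mem_range, not_exists] at hb
  induction j with
  | zero => exact fun _ => by simpa [walk] using ha
  | succ j ih =>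
    intro hj
    refine strictAnti_walk_of_injective hX (hτ (Nat.le_succ j)) (ih (by omega)) (hb j hj) ?_
    intro i i' hii
    by_contra hne
    exact hω (τ (j + 1)) ⟨hτ (Nat.zero_le _), hτ hj⟩ i i' hne hii

theorem sum_measureReal_bigStep_grid_le {Ω : Type*} [MeasurableSpace Ω] {μ : Measure Ω}
    [IsProbabilityMeasure μ] {n : ℕ} {X : Fin n → ℝ≥0 → Ω → ℕ}
    (hX : ∀ i, IsPoissonProcess 1 (X i) μ) {s t : ℝ≥0} (hst : s ≤ t) (m : ℕ) :
    ∑ k ∈ Finset.range (m + 1), μ.real (bigStep X (grid s t m k) (grid s t m (k + 1))) ≤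
      n * ((t : ℝ) - s) ^ 2 / (m + 1) := by
  calc _ ≤ ∑ k ∈ Finset.range (m + 1), (n : ℝ) * (((t : ℝ) - s) / (m + 1)) ^ 2 := by
        refine Finset.sum_le_sum fun k _ => ?_
        refine (measureReal_bigStep_le hX (grid_monotone s t m (Nat.le_succ k))).trans_eq ?_
        rw [coe_grid hst, coe_grid hst]
        push_cast
        ring
    _ = _ := by
        rw [Finset.sum_const, Finset.card_range, nsmul_eq_mul]
        push_cast
        field_simp

/-- Walks started in the Weyl chamber which do not intersect stay there almost surely. The
exceptional paths jump by at least `2` at some time. -/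
theorem measure_noIntersection_diff_inChamber {Ω : Type*} [MeasurableSpace Ω] {μ : Measure Ω}
    [IsProbabilityMeasure μ] {n : ℕ} {X : Fin n → ℝ≥0 → Ω → ℕ}
    (hX : ∀ i, IsPoissonProcess 1 (X i) μ) {s t : ℝ≥0} (hst : s ≤ t) {a : Fin n → ℤ}
    (ha : StrictAnti a) : μ (noIntersection X s a t \ inChamber X s a t) = 0 := by
  set B : ℕ → Set Ω := fun m =>
    ⋃ k ∈ Finset.range (m + 1), bigStep X (grid s t m k) (grid s t m (k + 1))
  have hsub : noIntersection X s a t \ inChamber X s a t ⊆ ⋃ m₀, ⋂ m ≥ m₀, B m := by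
    rintro ω ⟨h1, h2⟩
    obtain ⟨m₀, hm₀⟩ := eventually_atTop.1 (eventually_mem_gridChamber_iff hX hst a ω)
    refine Set.mem_iUnion.2 ⟨m₀, Set.mem_iInter₂.2 fun m hm => ?_⟩
    have h3 := noIntersection_subset_gridChamber_union hX (grid_monotone s t m) ha (m + 1)
    rw [grid_zero, grid_last hst] at h3
    exact (h3 h1).resolve_left fun h4 => h2 ((hm₀ m hm).1 h4)
  -- each of these intersections is contained in events `B m` of arbitrarily small probability
  refine measure_mono_null hsub (measure_iUnion_null fun m₀ => ?_)
  rw [← measureReal_eq_zero_iff]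
  refine le_antisymm (ge_of_tendsto (tendsto_const_div_add_one (n * ((t : ℝ) - s) ^ 2)) ?_)
    measureReal_nonneg
  filter_upwards [eventually_ge_atTop m₀] with m hm
  calc μ.real (⋂ m ≥ m₀, B m) ≤ μ.real (B m) :=
        measureReal_mono (Set.iInter₂_subset m hm) (measure_ne_top _ _)
    _ ≤ _ := (measureReal_biUnion_finset_le _ _).trans (sum_measureReal_bigStep_grid_le hX hst m)

/-- Up to a null set, the event of passing without intersection is the event of passing within
the Weyl chamber. -/
theorem passage_ae_eq {Ω : Type*} [MeasurableSpace Ω] {μ : Measure Ω}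
    [IsProbabilityMeasure μ] {n : ℕ} {X : Fin n → ℝ≥0 → Ω → ℕ}
    (hX : ∀ i, IsPoissonProcess 1 (X i) μ) {s t : ℝ≥0} (hst : s ≤ t) {a : Fin n → ℤ}
    (ha : StrictAnti a) (b : Fin n → ℤ) :
    passage X s a t b =ᵐ[μ] (inChamber X s a t ∩ endsAt X s a t b : Set Ω) := by
  have h : inChamber X s a t ⊆ noIntersection X s a t :=
    fun ω hω u hu i j hij => (hω u hu).injective.ne hij
  refine ae_eq_set_inter ?_ (EventuallyEq.refl _ _)
  exact (ae_le_set.2 (measure_noIntersection_diff_inChamber hX hst ha)).antisymm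
    (Eventually.of_forall h)

/-- The probability of a passage is the limit of probabilities of events that depend on the
locations at finitely many times. -/
theorem tendsto_measureReal_gridChamber {Ω : Type*} [MeasurableSpace Ω] {μ : Measure Ω}
    [IsProbabilityMeasure μ] {n : ℕ} {X : Fin n → ℝ≥0 → Ω → ℕ}
    (hX : ∀ i, IsPoissonProcess 1 (X i) μ) {s t : ℝ≥0} (hst : s ≤ t) {a : Fin n → ℤ}
    (ha : StrictAnti a) (b : Fin n → ℤ) :
    Tendsto (fun m : ℕ => μ.real (gridChamber X (grid s t m) a (m + 1) ∩ endsAt X s a t b)) atTop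
      (𝓝 (μ.real (passage X s a t b))) := by
  rw [measureReal_congr (passage_ae_eq hX hst ha b)]
  refine (ENNReal.tendsto_toReal (measure_ne_top _ _)).comp
    (tendsto_measure_of_tendsto_indicator_of_isFiniteMeasure atTop μ
      (fun m => (measurableSet_gridChamber hX _ a _).inter (measurableSet_endsAt hX s t a b))
      fun ω => ?_)
  filter_upwards [eventually_mem_gridChamber_iff hX hst a ω] with m hm
  simp only [Set.mem_inter_iff, hm]

/-- The **Karlin–McGregor formula** for Poisson processes. -/
theorem measureReal_passage_eq_det {Ω : Type*} [MeasurableSpace Ω] {μ : Measure Ω}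
    [IsProbabilityMeasure μ] {n : ℕ} {X : Fin n → ℝ≥0 → Ω → ℕ}
    (hX : ∀ i, IsPoissonProcess 1 (X i) μ) (hindep : iIndepFun (fun i ω s => X i s ω) μ)
    {s t : ℝ≥0} (hst : s ≤ t) {a b : Fin n → ℤ} (ha : StrictAnti a) (hb : StrictAnti b) :
    μ.real (passage X s a t b) =
      Matrix.det (Matrix.of fun i j : Fin n => poissonWeight ((t : ℝ) - s) (b i - a j)) := by
  refine tendsto_nhds_unique (tendsto_measureReal_gridChamber hX hst ha b) ?_
  rw [tendsto_iff_dist_tendsto_zero]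
  refine squeeze_zero (fun _ => dist_nonneg) (fun m => ?_)
    (tendsto_const_div_add_one (n.factorial * (n * ((t : ℝ) - s) ^ 2)))
  rw [dist_comm, Real.dist_eq, mul_div_assoc]
  have h := abs_det_sub_measureReal_gridChamber_le hX hindep (grid_monotone s t m) ha hb (m + 1)
  rw [grid_zero, grid_last hst] at h
  exact h.trans (mul_le_mul_of_nonneg_left (sum_measureReal_bigStep_grid_le hX hst m)
    (Nat.cast_nonneg _))

theorem measureReal_gridChamber_inter_gridChamber {Ω : Type*} [MeasurableSpace Ω] {μ : Measure Ω}
    {n : ℕ} {X : Fin n → ℝ≥0 → Ω → ℕ}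
    (hX : ∀ i, IsPoissonProcess 1 (X i) μ) (hindep : iIndepFun (fun i ω s => X i s ω) μ)
    {τ : ℕ → ℝ≥0} (hτ : Monotone τ) (a x b : Fin n → ℤ) (k l : ℕ) :
    μ.real ((gridChamber X τ a k ∩ endsAt X (τ 0) a (τ k) x) ∩
        (gridChamber X (fun j => τ (k + j)) x l ∩ endsAt X (τ k) x (τ (k + l)) b)) =
      μ.real (gridChamber X τ a k ∩ endsAt X (τ 0) a (τ k) x) *
        μ.real (gridChamber X (fun j => τ (k + j)) x l ∩ endsAt X (τ k) x (τ (k + l)) b) := by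
  have h := (indepFun_past_future hX hindep hτ k l).measure_inter_preimage_eq_mul
    {d | (∀ j : Fin (k + 1), StrictAnti fun i => a i + d (i, j)) ∧
      ∀ i, a i + d (i, Fin.last k) = x i}
    {d | (∀ j : Fin (l + 1), StrictAnti fun i => x i + d (i, j)) ∧
      ∀ i, x i + d (i, Fin.last l) = b i}
    (Set.to_countable _).measurableSet (Set.to_countable _).measurableSet
  have e1 : gridChamber X τ a k ∩ endsAt X (τ 0) a (τ k) x =
      (fun ω (q : Fin n × Fin (k + 1)) => (X q.1 (τ q.2) ω : ℤ) - X q.1 (τ 0) ω) ⁻¹'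
      {d | (∀ j : Fin (k + 1), StrictAnti fun i => a i + d (i, j)) ∧
        ∀ i, a i + d (i, Fin.last k) = x i} := by
    ext ω
    simp only [gridChamber, endsAt, walk, Set.mem_preimage, Set.mem_inter_iff, Set.mem_ofPred_eq,
      Fin.val_last, Fin.forall_iff, Nat.lt_succ_iff]
  have e2 : gridChamber X (fun j => τ (k + j)) x l ∩ endsAt X (τ k) x (τ (k + l)) b =
      (fun ω (q : Fin n × Fin (l + 1)) => (X q.1 (τ (k + q.2)) ω : ℤ) - X q.1 (τ k) ω) ⁻¹'
      {d | (∀ j : Fin (l + 1), StrictAnti fun i => x i + d (i, j)) ∧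
        ∀ i, x i + d (i, Fin.last l) = b i} := by
    ext ω
    simp only [gridChamber, endsAt, walk, Set.mem_preimage, Set.mem_inter_iff, Set.mem_ofPred_eq,
      Fin.val_last, Fin.forall_iff, Nat.lt_succ_iff, add_zero]
  rw [e1, e2]
  simp only [measureReal_def, h, ENNReal.toReal_mul]

/-- Passages during consecutive time intervals are independent. -/
theorem measureReal_passage_inter_passage {Ω : Type*} [MeasurableSpace Ω] {μ : Measure Ω}
    [IsProbabilityMeasure μ] {n : ℕ} {X : Fin n → ℝ≥0 → Ω → ℕ}
    (hX : ∀ i, IsPoissonProcess 1 (X i) μ) (hindep : iIndepFun (fun i ω s => X i s ω) μ)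
    {r s t : ℝ≥0} (hrs : r ≤ s) (hst : s ≤ t) {a x : Fin n → ℤ} (ha : StrictAnti a)
    (hx : StrictAnti x) (b : Fin n → ℤ) :
    μ.real (passage X r a s x ∩ passage X s x t b) =
      μ.real (passage X r a s x) * μ.real (passage X s x t b) := by
  have hprod : Tendsto (fun m : ℕ =>
      μ.real ((gridChamber X (grid r s m) a (m + 1) ∩ endsAt X r a s x) ∩
        (gridChamber X (grid s t m) x (m + 1) ∩ endsAt X s x t b))) atTop
      (𝓝 (μ.real (passage X r a s x ∩ passage X s x t b))) := by
    rw [measureReal_congr (ae_eq_set_inter (passage_ae_eq hX hrs ha x)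
      (passage_ae_eq hX hst hx b))]
    refine (ENNReal.tendsto_toReal (measure_ne_top _ _)).comp
      (tendsto_measure_of_tendsto_indicator_of_isFiniteMeasure atTop μ
        (fun m => ((measurableSet_gridChamber hX _ a _).inter
          (measurableSet_endsAt hX r s a x)).inter ((measurableSet_gridChamber hX _ x _).inter
          (measurableSet_endsAt hX s t x b))) fun ω => ?_)
    filter_upwards [eventually_mem_gridChamber_iff hX hrs a ω,
      eventually_mem_gridChamber_iff hX hst x ω] with m hm hm'
    simp only [Set.mem_inter_iff, hm, hm']
  refine tendsto_nhds_unique hprod (((tendsto_measureReal_gridChamber hX hrs ha x).mul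
    (tendsto_measureReal_gridChamber hX hst hx b)).congr fun m => ?_)
  -- the concatenation of the two grids
  set τ : ℕ → ℝ≥0 := fun j =>
    if j ≤ m + 1 then grid r s m j else grid s t m (j - (m + 1)) with hτdef
  have hleft : ∀ j ≤ m + 1, τ j = grid r s m j := fun j hj => if_pos hj
  have hright : ∀ j, τ (m + 1 + j) = grid s t m j := fun j => by
    rcases Nat.eq_zero_or_pos j with rfl | hj
    · rw [add_zero, hleft _ le_rfl, grid_last hrs, grid_zero]
    · rw [hτdef]
      simp only
      rw [if_neg (by omega), Nat.add_sub_cancel_left]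
  have hτ : Monotone τ := by
    refine monotone_nat_of_le_succ fun j => ?_
    rcases Nat.lt_or_ge j (m + 1) with hj | hj
    · rw [hleft j hj.le, hleft (j + 1) hj]
      exact grid_monotone r s m (Nat.le_succ j)
    · obtain ⟨j, rfl⟩ := Nat.exists_eq_add_of_le hj
      rw [hright j, add_assoc, hright (j + 1)]
      exact grid_monotone s t m (Nat.le_succ j)
  have h0 : τ 0 = r := by rw [hleft 0 (Nat.zero_le _), grid_zero]
  have h1 : τ (m + 1) = s := by rw [hleft _ le_rfl, grid_last hrs]
  have h2 : τ (m + 1 + (m + 1)) = t := by rw [hright, grid_last hst]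
  have h := measureReal_gridChamber_inter_gridChamber hX hindep hτ a x b (m + 1) (m + 1)
  have hchamber : gridChamber X τ a (m + 1) = gridChamber X (grid r s m) a (m + 1) := by
    ext ω
    exact forall₂_congr fun j hj => by rw [hleft j hj, h0, grid_zero]
  rw [hchamber, show (fun j => τ (m + 1 + j)) = grid s t m from funext hright, h0, h1, h2] at h
  exact h.symm

theorem passage_inter_endsAt {Ω : Type*} {n : ℕ} (X : Fin n → ℝ≥0 → Ω → ℕ) {r s t : ℝ≥0}
    (hrs : r ≤ s) (hst : s ≤ t) (a x b : Fin n → ℤ) :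
    passage X r a t b ∩ endsAt X r a s x = passage X r a s x ∩ passage X s x t b := by
  have key : ∀ ω, ω ∈ endsAt X r a s x → ∀ u i, walk X r a u i ω = walk X s x u i ω := by
    intro ω h u i
    have := h i
    simp only [walk] at *
    omega
  ext ω
  constructor
  · rintro ⟨⟨h1, h2⟩, h3⟩
    refine ⟨⟨fun u hu => h1 u ⟨hu.1, hu.2.trans hst⟩, h3⟩, fun u hu => ?_, fun i => ?_⟩
    · simpa only [key ω h3] using h1 u ⟨hrs.trans hu.1, hu.2⟩
    · rw [← key ω h3]
      exact h2 i
  · rintro ⟨⟨h1, h3⟩, h4, h5⟩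
    refine ⟨⟨fun u hu => ?_, fun i => ?_⟩, h3⟩
    · rcases le_total u s with hus | hsu
      · exact h1 u ⟨hu.1, hus⟩
      · simpa only [key ω h3] using h4 u ⟨hsu, hu.2⟩
    · rw [key ω h3]
      exact h5 i

end

/-! ### Evaluation of the determinants -/

/-- The falling factorials are monic polynomials of increasing degrees, so they can replace the
powers in a Vandermonde determinant. -/
theorem det_descFactorial {n : ℕ} (z : Fin n → ℕ) :
    Matrix.det (Matrix.of fun i j : Fin n => ((z j).descFactorial i : ℝ)) =
      ∏ i : Fin n, ∏ j ∈ Finset.Ioi i, ((z j : ℝ) - z i) := by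
  rw [← Matrix.det_vandermonde, Matrix.det_eval_matrixOfPolynomials_eq_det_vandermonde
    (fun i => (z i : ℝ)) (fun i => descPochhammer ℝ i) (fun i => descPochhammer_natDegree ℝ i)
    (fun i => monic_descPochhammer ℝ i), ← Matrix.det_transpose]
  congr 1
  ext i j
  simp [descPochhammer_eval_eq_descFactorial]

theorem det_descFactorial_div_factorial {n : ℕ} (z : Fin n → ℕ) :
    Matrix.det (Matrix.of fun i j : Fin n => ((z j).descFactorial i : ℝ) / (z j).factorial) =
      (∏ j, ((z j).factorial : ℝ)⁻¹) * ∏ i : Fin n, ∏ j ∈ Finset.Ioi i, ((z j : ℝ) - z i) := by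
  rw [← det_descFactorial, ← Matrix.det_mul_row]
  congr 1
  ext i j
  simp [div_eq_inv_mul]

/-- The convention `1 / k! = 0` for negative `k` agrees with the vanishing of the falling factorial
`z (z - 1) ⋯ (z - i + 1)` for `z < i`. -/
theorem poissonWeight_sub_eq {s : ℝ} (hs : s ≠ 0) (z i : ℕ) :
    poissonWeight s ((z : ℤ) - i) =
      (s ^ i)⁻¹ * (Real.exp (-s) * s ^ z * ((z.descFactorial i : ℝ) / z.factorial)) := by
  unfold poissonWeight
  rcases le_or_gt i z with h | h
  · have h1 : ((z : ℤ) - i) = ((z - i : ℕ) : ℤ) := by omega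
    rw [if_pos (by omega), h1, Int.toNat_natCast, ← Nat.factorial_mul_descFactorial h]
    have h2 : s ^ z = s ^ (z - i) * s ^ i := by rw [← pow_add, Nat.sub_add_cancel h]
    have h3 : ((z - i).factorial : ℝ) ≠ 0 := Nat.cast_ne_zero.2 (Nat.factorial_ne_zero _)
    have h4 : (z.descFactorial i : ℝ) ≠ 0 :=
      Nat.cast_ne_zero.2 (Nat.pos_iff_ne_zero.1 (Nat.pow_sub_le_descFactorial z i |>.trans_lt' (by
        have : 0 < z + 1 - i := by omega
        positivity)))
    rw [h2]
    push_cast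
    field_simp
  · rw [if_neg (by omega), Nat.descFactorial_of_lt h]
    simp

theorem det_poissonWeight {n : ℕ} {s : ℝ} (hs : s ≠ 0) (z : Fin n → ℕ) :
    Matrix.det (Matrix.of fun i j : Fin n => poissonWeight s ((z j : ℤ) - (i : ℕ))) =
      (∏ j, Real.exp (-s) * s ^ z j * ((z j).factorial : ℝ)⁻¹) * (s ^ (n * (n - 1) / 2))⁻¹ *
        ∏ i : Fin n, ∏ j ∈ Finset.Ioi i, ((z j : ℝ) - z i) := by
  have h1 : (Matrix.of fun i j : Fin n => poissonWeight s ((z j : ℤ) - (i : ℕ))) =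
      Matrix.of fun i j : Fin n => (s ^ (i : ℕ))⁻¹ * Matrix.of (fun i j : Fin n =>
        (Real.exp (-s) * s ^ z j) * Matrix.of (fun i j : Fin n =>
          ((z j).descFactorial i : ℝ) / (z j).factorial) i j) i j := by
    ext i j
    simp only [Matrix.of_apply]
    exact poissonWeight_sub_eq hs _ _
  rw [h1, Matrix.det_mul_column, Matrix.det_mul_row, det_descFactorial_div_factorial,
    Finset.prod_inv_distrib, Finset.prod_pow_eq_pow_sum,
    Fin.sum_univ_eq_sum_range (fun i => i) n, Finset.sum_range_id,
    Finset.prod_mul_distrib (g := fun j => ((z j).factorial : ℝ)⁻¹)]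
  ring

theorem prod_Ioi_rev {n : ℕ} (f : Fin n → Fin n → ℝ) :
    ∏ i : Fin n, ∏ j ∈ Finset.Ioi i, f i.rev j.rev = ∏ i : Fin n, ∏ j ∈ Finset.Ioi i, f j i := by
  rw [Finset.prod_sigma', Finset.prod_sigma']
  refine Finset.prod_bij' (fun q _ => ⟨q.2.rev, q.1.rev⟩) (fun q _ => ⟨q.2.rev, q.1.rev⟩)
    ?_ ?_ ?_ ?_ ?_ <;> simp

theorem prod_Ioi_cast_sub {n : ℕ} :
    ∏ i : Fin n, ∏ j ∈ Finset.Ioi i, (((j : ℕ) : ℝ) - (i : ℕ)) =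
      ∏ i : Fin n, ((i : ℕ).factorial : ℝ) := by
  cases n with
  | zero => simp
  | succ n =>
    have h := Matrix.det_vandermonde_id_eq_superFactorial (R := ℝ) n
    rw [Matrix.det_vandermonde] at h
    rw [h, ← Nat.prod_range_succ_factorial, Fin.prod_univ_eq_prod_range
      (fun i => (i.factorial : ℝ)), Nat.cast_prod]

theorem det_rev {n : ℕ} (A : Matrix (Fin n) (Fin n) ℝ) :
    Matrix.det (Matrix.of fun i j : Fin n => A i.rev j.rev) = Matrix.det A :=
  Matrix.det_submatrix_equiv_self Fin.revPerm A

theorem det_inv_factorial {n N : ℕ} (hN : n < N) :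
    Matrix.det (Matrix.of fun i j : Fin n =>
      1 / (Nat.factorial (N + (i : ℕ) - (j : ℕ)) : ℝ)) =
      ∏ i : Fin n, ((i : ℕ).factorial : ℝ) / ((N + (i : ℕ)).factorial : ℝ) := by
  have h := det_descFactorial_div_factorial fun j : Fin n => N + (j : ℕ)
  rw [← det_rev]
  convert! h using 1
  · congr 1
    ext i j
    have hi := i.2
    have hj := j.2
    simp only [Matrix.of_apply, Fin.val_rev]
    rw [show N + (n - (i + 1)) - (n - (j + 1)) = N + j - i by omega,
      ← Nat.factorial_mul_descFactorial (show (i : ℕ) ≤ N + j by omega)]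
    have h1 : (((N + j - i : ℕ)).factorial : ℝ) ≠ 0 := Nat.cast_ne_zero.2 (Nat.factorial_ne_zero _)
    have h2 : ((N + (j : ℕ)).descFactorial i : ℝ) ≠ 0 := by
      rw [Nat.cast_ne_zero, Ne, Nat.descFactorial_eq_zero_iff_lt]
      omega
    push_cast
    field_simp
  · simp only [Nat.cast_add, add_sub_add_left_eq_sub, prod_Ioi_cast_sub]
    rw [← Finset.prod_mul_distrib]
    exact Finset.prod_congr rfl fun i _ => by ring

theorem det_poissonWeight_initial {n : ℕ} {t : ℝ} (ht : t ≠ 0) {x : Fin n → ℤ} {y : Fin n → ℕ}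
    (hxy : ∀ j, (y j : ℤ) = x j + (n : ℤ) - 1) :
    Matrix.det (Matrix.of fun i j : Fin n => poissonWeight t (x j + (i : ℤ))) =
      (∏ j, Real.exp (-t) * t ^ y j * ((y j).factorial : ℝ)⁻¹) * (t ^ (n * (n - 1) / 2))⁻¹ *
        ∏ i : Fin n, ∏ j ∈ Finset.Ioi i, ((y i : ℝ) - y j) := by
  have h := det_poissonWeight ht fun j : Fin n => y j.rev
  rw [← det_rev]
  convert! h using 1
  · congr 1
    ext i j
    have hi := i.2
    simp only [Matrix.of_apply, Fin.val_rev, hxy]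
    congr 1
    omega
  · rw [prod_Ioi_rev fun i j => (y j : ℝ) - y i]
    congr 2
    exact (Equiv.prod_comp Fin.revPerm
      fun j => Real.exp (-t) * t ^ y j * ((y j).factorial : ℝ)⁻¹).symm

theorem det_poissonWeight_terminal {n N : ℕ} {s : ℝ} (hs : s ≠ 0) {x : Fin n → ℤ}
    {y : Fin n → ℕ} (hxy : ∀ j, (y j : ℤ) = x j + (n : ℤ) - 1) (hy : ∀ j, y j ≤ N + n - 1) :
    Matrix.det (Matrix.of fun i j : Fin n => poissonWeight s ((N : ℤ) - (i : ℤ) - x j)) =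
      (∏ j, Real.exp (-s) * s ^ (N + n - 1 - y j) * ((N + n - 1 - y j).factorial : ℝ)⁻¹) *
        (s ^ (n * (n - 1) / 2))⁻¹ * ∏ i : Fin n, ∏ j ∈ Finset.Ioi i, ((y i : ℝ) - y j) := by
  have h := det_poissonWeight hs fun j : Fin n => N + n - 1 - y j
  convert! h using 1
  · congr 1
    ext i j
    have hi := i.2
    have h1 := hxy j
    have h2 := hy j
    simp only [Matrix.of_apply]
    congr 1
    omega
  · congr 1
    refine Finset.prod_congr rfl fun i _ => Finset.prod_congr rfl fun j _ => ?_
    rw [Nat.cast_sub (hy i), Nat.cast_sub (hy j)]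
    ring

theorem det_poissonWeight_initial_terminal {n N : ℕ} {s : ℝ} (hs : s ≠ 0) :
    Matrix.det (Matrix.of fun i j : Fin n => poissonWeight s ((N : ℤ) + (i : ℤ) - (j : ℤ))) =
      Real.exp (-s) ^ n * s ^ (n * N) *
        ∏ i : Fin n, ((i : ℕ).factorial : ℝ) / ((N + (i : ℕ)).factorial : ℝ) := by
  have h := det_poissonWeight hs fun j : Fin n => N + (j : ℕ)
  rw [← det_rev]
  convert! h using 1
  · congr 1
    ext i j
    have hi := i.2
    have hj := j.2
    simp only [Matrix.of_apply, Fin.val_rev]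
    congr 1
    omega
  · simp only [Nat.cast_add, add_sub_add_left_eq_sub, prod_Ioi_cast_sub, pow_add,
      Finset.prod_mul_distrib, Finset.prod_div_distrib, Finset.prod_inv_distrib]
    rw [Finset.prod_pow_eq_pow_sum _ (fun i : Fin n => (i : ℕ)),
      Fin.sum_univ_eq_sum_range (fun i => i) n, Finset.sum_range_id]
    simp only [← pow_mul, Finset.prod_const, Finset.card_univ, Fintype.card_fin]
    field_simp
    ring

/-- The product of the first two Karlin–McGregor determinants divided by the third one is the
Krawtchouk weight with an explicit constant. -/
theorem det_mul_det_div_det {n N : ℕ} (hN : n < N) {t T p : ℝ} (ht : 0 < t) (htT : t < T)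
    (hp : p = t / T) {x : Fin n → ℤ} {y : Fin n → ℕ}
    (hxy : ∀ j, (y j : ℤ) = x j + (n : ℤ) - 1) (hy : ∀ j, y j ≤ N + n - 1) :
    Matrix.det (Matrix.of fun i j : Fin n => poissonWeight t (x j + (i : ℤ))) *
      Matrix.det (Matrix.of fun i j : Fin n => poissonWeight (T - t) ((N : ℤ) - (i : ℤ) - x j)) /
      Matrix.det (Matrix.of fun i j : Fin n => poissonWeight T ((N : ℤ) + (i : ℤ) - (j : ℤ))) =
    ((Nat.factorial (N + n - 1) : ℝ) ^ n)⁻¹ *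
      (∏ i : Fin n, (Nat.factorial (N + (i : ℕ)) : ℝ) / (Nat.factorial (i : ℕ) : ℝ)) *
      ((p - p ^ 2) ^ (n * (n - 1) / 2))⁻¹ * vandermondeSq y *
      ∏ j : Fin n, binomialWeight (N + n - 1) p (y j) := by
  have hT : 0 < T := ht.trans htT
  have hs : 0 < T - t := sub_pos.2 htT
  rw [det_poissonWeight_initial ht.ne' hxy, det_poissonWeight_terminal hs.ne' hxy hy,
    det_poissonWeight_initial_terminal hT.ne']
  set M := N + n - 1 with hM
  set C := n * (n - 1) / 2 with hC
  -- the powers of `T` balance although `C` is defined by division of natural numbers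
  have hMC : n * M = n * N + (C + C) := by
    have h1 : n * (n - 1) / 2 * 2 = n * (n - 1) :=
      Nat.div_mul_cancel (Nat.even_mul_pred_self n).two_dvd
    rcases n with _ | n
    · simp [hC]
    · have h2 : M = N + n := by omega
      rw [h2, mul_add]
      simp only [Nat.add_sub_cancel] at h1 hC
      rw [hC]
      omega
  have hbin : ∀ j, binomialWeight M p (y j) = (M.factorial / T ^ M) *
      (t ^ y j * ((y j).factorial : ℝ)⁻¹ *
        ((T - t) ^ (M - y j) * ((M - y j).factorial : ℝ)⁻¹)) := by
    intro j
    have h1 : T ^ M = T ^ y j * T ^ (M - y j) := by rw [← pow_add, Nat.add_sub_cancel' (hy j)]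
    have h2 : 1 - p = (T - t) / T := by rw [hp]; field_simp
    rw [binomialWeight, Nat.cast_choose ℝ (hy j), h2, hp, div_pow, div_pow, h1]
    field_simp
  have hpp : p - p ^ 2 = t * (T - t) / (T * T) := by rw [hp]; field_simp
  have hexp : Real.exp (-t) * Real.exp (-(T - t)) = Real.exp (-T) := by
    rw [← Real.exp_add]; ring_nf
  have hV : vandermondeSq y = (∏ i : Fin n, ∏ j ∈ Finset.Ioi i, ((y i : ℝ) - y j)) *
      ∏ i : Fin n, ∏ j ∈ Finset.Ioi i, ((y i : ℝ) - y j) := by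
    simp only [vandermondeSq, ← Finset.prod_mul_distrib]
    exact Finset.prod_congr rfl fun i _ => Finset.prod_congr rfl fun j _ => by ring
  have hTpow : (T ^ M) ^ n = T ^ (n * N) * (T ^ C * T ^ C) := by
    rw [← pow_mul, mul_comm M n, hMC, pow_add, pow_add]
  have hf : ∏ i : Fin n, ((i : ℕ).factorial : ℝ) ≠ 0 :=
    Finset.prod_ne_zero_iff.2 fun i _ => Nat.cast_ne_zero.2 (Nat.factorial_ne_zero _)
  have hf' : ∏ i : Fin n, ((N + (i : ℕ)).factorial : ℝ) ≠ 0 :=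
    Finset.prod_ne_zero_iff.2 fun i _ => Nat.cast_ne_zero.2 (Nat.factorial_ne_zero _)
  have hMf : (M.factorial : ℝ) ≠ 0 := Nat.cast_ne_zero.2 (Nat.factorial_ne_zero _)
  simp only [hbin, hV, hpp, Finset.prod_mul_distrib, Finset.prod_div_distrib,
    Finset.prod_const, Finset.card_univ, Fintype.card_fin, div_pow, mul_pow, ← hexp, hTpow]
  have e1 := (Real.exp_pos (-t)).ne'
  have e2 := (Real.exp_pos (-(T - t))).ne'
  field_simp

/-! ### The conditioned process at a fixed time -/

theorem strictAnti_initial (n : ℕ) : StrictAnti (initial n) := by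
  intro i j hij
  simp only [initial]
  have : (i : ℕ) < j := hij
  omega

theorem strictAnti_terminal (n N : ℕ) : StrictAnti (terminal n N) := by
  intro i j hij
  simp only [terminal]
  have : (i : ℕ) < j := hij
  omega

theorem endsAt_initial_eq_busesAt {Ω : Type*} {n : ℕ} (X : Fin n → ℝ≥0 → Ω → ℕ) (t : ℝ≥0)
    (x : Fin n → ℤ) : endsAt X 0 (initial n) t x = busesAt X t x := rfl

theorem measureReal_passage_initial {Ω : Type*} [MeasurableSpace Ω] {μ : Measure Ω}
    [IsProbabilityMeasure μ] {n : ℕ} {X : Fin n → ℝ≥0 → Ω → ℕ}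
    (hX : ∀ i, IsPoissonProcess 1 (X i) μ) (hindep : iIndepFun (fun i ω s => X i s ω) μ)
    (t : ℝ≥0) {x : Fin n → ℤ} (hx : StrictAnti x) :
    μ.real (passage X 0 (initial n) t x) =
      Matrix.det (Matrix.of fun i j : Fin n => poissonWeight t (x j + (i : ℤ))) := by
  rw [measureReal_passage_eq_det hX hindep zero_le (strictAnti_initial n) hx,
    ← Matrix.det_transpose]
  congr 1
  ext i j
  simp [initial]

theorem measureReal_passage_initial_terminal {Ω : Type*} [MeasurableSpace Ω] {μ : Measure Ω}
    [IsProbabilityMeasure μ] {n : ℕ} {X : Fin n → ℝ≥0 → Ω → ℕ}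
    (hX : ∀ i, IsPoissonProcess 1 (X i) μ) (hindep : iIndepFun (fun i ω s => X i s ω) μ)
    (N : ℕ) (T : ℝ≥0) :
    μ.real (passage X 0 (initial n) T (terminal n N)) =
      Matrix.det (Matrix.of fun i j : Fin n => poissonWeight T ((N : ℤ) + (i : ℤ) - (j : ℤ))) := by
  rw [measureReal_passage_initial hX hindep T (strictAnti_terminal n N)]
  congr 1
  ext i j
  simp only [Matrix.of_apply, terminal]
  congr 1
  ring

theorem measureReal_passage_initial_terminal_pos {Ω : Type*} [MeasurableSpace Ω] {μ : Measure Ω}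
    [IsProbabilityMeasure μ] {n : ℕ} {X : Fin n → ℝ≥0 → Ω → ℕ}
    (hX : ∀ i, IsPoissonProcess 1 (X i) μ) (hindep : iIndepFun (fun i ω s => X i s ω) μ)
    (N : ℕ) {T : ℝ≥0} (hT : 0 < T) :
    0 < μ.real (passage X 0 (initial n) T (terminal n N)) := by
  have hT' : (0 : ℝ) < T := hT
  rw [measureReal_passage_initial_terminal hX hindep,
    det_poissonWeight_initial_terminal hT'.ne']
  refine mul_pos (by positivity) (Finset.prod_pos fun i _ => ?_)
  positivity

/-- The conditioning event need not be measurable here, since the event `busesAt` is. -/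
theorem busLaw_real_busesAt {Ω : Type*} [MeasurableSpace Ω] {μ : Measure Ω}
    [IsProbabilityMeasure μ] {n : ℕ} {X : Fin n → ℝ≥0 → Ω → ℕ}
    (hX : ∀ i, IsPoissonProcess 1 (X i) μ) (N : ℕ) {t T : ℝ≥0} (htT : t ≤ T) (x : Fin n → ℤ) :
    (busLaw μ X N T).real (busesAt X t x) =
      μ.real (passage X 0 (initial n) t x ∩ passage X t x T (terminal n N)) /
        μ.real (passage X 0 (initial n) T (terminal n N)) := by
  rw [busLaw, measureReal_def, ← endsAt_initial_eq_busesAt,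
    cond_apply' (measurableSet_endsAt hX 0 t (initial n) x), passage_inter_endsAt X zero_le htT,
    ENNReal.toReal_mul, ENNReal.toReal_inv, ← measureReal_def, ← measureReal_def, div_eq_inv_mul]

/-- The buses are almost surely strictly decreasing, and each of them stays between its initial
location, at least `1 - n`, and its terminal location, at most `N`. -/
theorem busLaw_real_busesAt_eq_zero {Ω : Type*} [MeasurableSpace Ω] {μ : Measure Ω}
    [IsProbabilityMeasure μ] {n : ℕ} {X : Fin n → ℝ≥0 → Ω → ℕ}
    (hX : ∀ i, IsPoissonProcess 1 (X i) μ) (N : ℕ) {t T : ℝ≥0} (htT : t ≤ T) {x : Fin n → ℤ}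
    (hx : ¬ (StrictAnti x ∧
      ∀ j, 0 ≤ x j + (n : ℤ) - 1 ∧ x j + (n : ℤ) - 1 ≤ (N : ℤ) + n - 1)) :
    (busLaw μ X N T).real (busesAt X t x) = 0 := by
  rw [busLaw_real_busesAt hX N htT, div_eq_zero_iff]
  left
  by_cases hanti : StrictAnti x
  · have : passage X 0 (initial n) t x ∩ passage X t x T (terminal n N) = ∅ := by
      ext ω
      simp only [Set.mem_empty_iff_false, iff_false]
      rintro ⟨⟨-, h1⟩, -, h2⟩
      refine hx ⟨hanti, fun j => ?_⟩
      have h3 : X j 0 ω ≤ X j t ω := (hX j).mono ω zero_le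
      have h4 : X j t ω ≤ X j T ω := (hX j).mono ω htT
      have h5 := h1 j
      have h6 := h2 j
      have hj := j.2
      simp only [walk, initial, terminal] at h5 h6
      omega
    rw [this, measureReal_empty]
  · have : μ.real (passage X 0 (initial n) t x) = 0 := by
      rw [measureReal_congr (passage_ae_eq hX zero_le (strictAnti_initial n) x)]
      have : inChamber X 0 (initial n) t ∩ endsAt X 0 (initial n) t x = ∅ := by
        ext ω
        simp only [Set.mem_inter_iff, Set.mem_empty_iff_false, iff_false, not_and]
        intro h1 h2
        have h3 := h1 t ⟨zero_le, le_rfl⟩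
        rw [show (fun i => walk X 0 (initial n) t i ω) = x from funext h2] at h3
        exact hanti h3
      rw [this, measureReal_empty]
    exact le_antisymm ((measureReal_mono Set.inter_subset_left (measure_ne_top _ _)).trans
      this.le) measureReal_nonneg

theorem mem_configurations {n M : ℕ} {y : Fin n → ℕ} :
    y ∈ configurations n M ↔ (∀ j, y j ≤ M) ∧ StrictAnti y := by
  simp [configurations]

/-- The location `x_j = y_j + 1 - n` of the buses in terms of the particles `y_j` of the Krawtchouk
ensemble. -/
def busLocation {n : ℕ} (y : Fin n → ℕ) (j : Fin n) : ℤ := (y j : ℤ) + 1 - n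

theorem sum_busLaw_real_busesAt {Ω : Type*} [MeasurableSpace Ω] {μ : Measure Ω}
    [IsProbabilityMeasure μ] {n N : ℕ} (hN : n < N) {X : Fin n → ℝ≥0 → Ω → ℕ}
    (hX : ∀ i, IsPoissonProcess 1 (X i) μ) (hindep : iIndepFun (fun i ω s => X i s ω) μ)
    {t T : ℝ≥0} (ht : 0 < t) (htT : t ≤ T) :
    ∑ z ∈ configurations n (N + n - 1),
      (busLaw μ X N T).real (busesAt X t (busLocation z)) = 1 := by
  have hpos := measureReal_passage_initial_terminal_pos hX hindep N (ht.trans_le htT)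
  have : IsProbabilityMeasure (busLaw μ X N T) :=
    cond_isProbabilityMeasure (fun h => hpos.ne' (by rw [measureReal_def, h, ENNReal.toReal_zero]))
  have hm : ∀ x, MeasurableSet (busesAt X t x) := measurableSet_endsAt hX 0 t (initial n)
  rw [← measureReal_biUnion_finset (fun z _ w _ hzw => ?_) (fun z _ => hm _)]
  · have hcompl := probReal_compl_eq_one_sub (μ := busLaw μ X N T)
      (Finset.measurableSet_biUnion (configurations n (N + n - 1))
        fun z _ => hm (busLocation z))
    rw [eq_comm, ← sub_eq_zero, ← hcompl, measureReal_eq_zero_iff]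
    have hsub : (⋃ z ∈ configurations n (N + n - 1), busesAt X t (busLocation z))ᶜ ⊆
        ⋃ x ∈ {x : Fin n → ℤ | ¬ (StrictAnti x ∧
          ∀ j, 0 ≤ x j + (n : ℤ) - 1 ∧ x j + (n : ℤ) - 1 ≤ (N : ℤ) + n - 1)},
          busesAt X t x := by
      intro ω hω
      refine Set.mem_iUnion₂.2 ⟨fun i => walk X 0 (initial n) t i ω, ?_, fun i => rfl⟩
      rintro ⟨h1, h2⟩
      refine hω (Set.mem_iUnion₂.2
        ⟨fun i => (walk X 0 (initial n) t i ω + (n : ℤ) - 1).toNat,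
          mem_configurations.2 ⟨fun j => ?_, fun i j hij => ?_⟩, fun j => ?_⟩)
      · have := h2 j
        simp only at this ⊢
        omega
      · have h3 := h1 hij
        have := h2 i
        have := h2 j
        simp only at *
        omega
      · have := h2 j
        simp only [busLocation] at this ⊢
        omega
    refine measure_mono_null hsub ((measure_biUnion_null_iff (Set.to_countable _)).2 fun x hx => ?_)
    rw [← measureReal_eq_zero_iff]
    exact busLaw_real_busesAt_eq_zero hX N htT hx
  · refine Set.disjoint_left.2 fun ω h1 h2 => hzw (funext fun j => ?_)
    have h3 := (h1 j).symm.trans (h2 j)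
    simp only [busLocation] at h3
    omega

end BusModel

theorem lemma2 {Ω : Type*} [MeasurableSpace Ω] (μ : Measure Ω) [IsProbabilityMeasure μ]
    (n N : ℕ) (hN : n < N) (T t : ℝ≥0) (ht : 0 < t) (htT : t < T) (p : ℝ) (hp : p = (t : ℝ) / T)
    (X : Fin n → ℝ≥0 → Ω → ℕ)
    (hX : ∀ i, BusModel.IsPoissonProcess 1 (X i) μ)
    (hindep : iIndepFun (fun i ω s => X i s ω) μ) :
    -- the three Karlin-McGregor formulas
    (∀ x : Fin n → ℤ, StrictAnti x →
      μ.real (BusModel.passage X 0 (BusModel.initial n) t x) =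
        Matrix.det (Matrix.of fun i j : Fin n =>
          BusModel.poissonWeight t (x j + (i : ℤ)))) ∧
    (∀ x : Fin n → ℤ, StrictAnti x →
      μ.real (BusModel.passage X t x T (BusModel.terminal n N)) =
        Matrix.det (Matrix.of fun i j : Fin n =>
          BusModel.poissonWeight ((T : ℝ) - t) ((N : ℤ) - (i : ℤ) - x j))) ∧
    (μ.real (BusModel.passage X 0 (BusModel.initial n) T (BusModel.terminal n N)) =
        Matrix.det (Matrix.of fun i j : Fin n =>
          BusModel.poissonWeight T ((N : ℤ) + (i : ℤ) - (j : ℤ)))) ∧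
    -- the fixed-time law of the conditioned process as a ratio
    (∀ x : Fin n → ℤ, StrictAnti x →
      (BusModel.busLaw μ X N T).real (BusModel.busesAt X t x) =
        μ.real (BusModel.passage X 0 (BusModel.initial n) t x) *
          μ.real (BusModel.passage X t x T (BusModel.terminal n N)) /
          μ.real (BusModel.passage X 0 (BusModel.initial n) T (BusModel.terminal n N))) ∧
    -- the determinant identity
    ((Matrix.det (Matrix.of fun i j : Fin n =>
        1 / (Nat.factorial (N + (i : ℕ) - (j : ℕ)) : ℝ)))⁻¹ =
      ∏ i : Fin n, (Nat.factorial (N + (i : ℕ)) : ℝ) / (Nat.factorial (i : ℕ) : ℝ)) ∧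
    -- the explicit fixed-time law, on its support
    (∀ (x : Fin n → ℤ) (y : Fin n → ℕ), StrictAnti x →
      (∀ j, (y j : ℤ) = x j + (n : ℤ) - 1) → (∀ j, y j ≤ N + n - 1) →
      (BusModel.busLaw μ X N T).real (BusModel.busesAt X t x) =
          ((Nat.factorial (N + n - 1) : ℝ) ^ n)⁻¹ *
          (∏ i : Fin n, (Nat.factorial (N + (i : ℕ)) : ℝ) / (Nat.factorial (i : ℕ) : ℝ)) *
          ((p - p ^ 2) ^ (n * (n - 1) / 2))⁻¹ *
          BusModel.vandermondeSq y *
          ∏ j : Fin n, BusModel.binomialWeight (N + n - 1) p (y j) ∧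
      (BusModel.busLaw μ X N T).real (BusModel.busesAt X t x) =
        BusModel.krawtchoukEnsemble n (N + n - 1) p y) ∧
    -- all other configurations have probability zero
    (∀ x : Fin n → ℤ,
      ¬ (StrictAnti x ∧ ∀ j, 0 ≤ x j + (n : ℤ) - 1 ∧ x j + (n : ℤ) - 1 ≤ (N : ℤ) + n - 1) →
      (BusModel.busLaw μ X N T).real (BusModel.busesAt X t x) = 0) := by
  have hfirst := fun x (hx : StrictAnti x) =>
    BusModel.measureReal_passage_initial hX hindep t hx
  have hsecond := fun x (hx : StrictAnti x) =>
    BusModel.measureReal_passage_eq_det hX hindep htT.le hx (BusModel.strictAnti_terminal n N)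
  have hthird := BusModel.measureReal_passage_initial_terminal hX hindep N T
  have hratio : ∀ x : Fin n → ℤ, StrictAnti x →
      (BusModel.busLaw μ X N T).real (BusModel.busesAt X t x) =
        μ.real (BusModel.passage X 0 (BusModel.initial n) t x) *
          μ.real (BusModel.passage X t x T (BusModel.terminal n N)) /
          μ.real (BusModel.passage X 0 (BusModel.initial n) T (BusModel.terminal n N)) :=
    fun x hx => by
      rw [BusModel.busLaw_real_busesAt hX N htT.le,
        BusModel.measureReal_passage_inter_passage hX hindep zero_le htT.le
          (BusModel.strictAnti_initial n) hx]
  set c : ℝ := ((Nat.factorial (N + n - 1) : ℝ) ^ n)⁻¹ *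
    (∏ i : Fin n, (Nat.factorial (N + (i : ℕ)) : ℝ) / (Nat.factorial (i : ℕ) : ℝ)) *
    ((p - p ^ 2) ^ (n * (n - 1) / 2))⁻¹
  have hexplicit : ∀ (x : Fin n → ℤ) (y : Fin n → ℕ), StrictAnti x →
      (∀ j, (y j : ℤ) = x j + (n : ℤ) - 1) → (∀ j, y j ≤ N + n - 1) →
      (BusModel.busLaw μ X N T).real (BusModel.busesAt X t x) = c * BusModel.vandermondeSq y *
        ∏ j : Fin n, BusModel.binomialWeight (N + n - 1) p (y j) := fun x y hx hxy hy => by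
    rw [hratio x hx, hfirst x hx, hsecond x hx, hthird]
    exact BusModel.det_mul_det_div_det hN ht htT hp hxy hy
  -- the total mass of the law determines the normalization of the ensemble
  have hmass : c * ∑ z ∈ BusModel.configurations n (N + n - 1), BusModel.vandermondeSq z *
      ∏ j, BusModel.binomialWeight (N + n - 1) p (z j) = 1 := by
    rw [← BusModel.sum_busLaw_real_busesAt hN hX hindep ht htT.le, Finset.mul_sum]
    refine Finset.sum_congr rfl fun z hz => ?_
    obtain ⟨hz1, hz2⟩ := BusModel.mem_configurations.1 hz
    have hanti : StrictAnti (BusModel.busLocation z) := fun i j hij => by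
      have := hz2 hij
      simp only [BusModel.busLocation]
      omega
    rw [hexplicit (BusModel.busLocation z) z hanti
      (fun j => by simp only [BusModel.busLocation]; ring) hz1]
    exact (mul_assoc _ _ _).symm
  refine ⟨hfirst, hsecond, hthird, hratio, ?_, fun x y hx hxy hy => ⟨hexplicit x y hx hxy hy, ?_⟩,
    fun x hx => BusModel.busLaw_real_busesAt_eq_zero hX N htT.le hx⟩
  · rw [BusModel.det_inv_factorial hN, ← Finset.prod_inv_distrib]
    exact Finset.prod_congr rfl fun i _ => inv_div _ _
  · rw [hexplicit x y hx hxy hy, BusModel.krawtchoukEnsemble, eq_inv_of_mul_eq_one_left hmass]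
    ring
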